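/- Let $\mathcal N$ be a homogeneous Poisson point process in $\mathbb R^2$ with intensity $1$, let $\rho>0$, and let $O$ be the origin of $\mathbb R^2$. Write $|\cdot|$ for the Euclidean norm and $B(O,s)$ for the open Euclidean ball with center $O$ and radius $s$. For $X\in\mathbb R^2$ let $$\mathrm{Cyl}(X,\rho)=\big([O;X]\oplus B(O,\rho)\big)\cap B(O,|X|),$$ where $\oplus$ is the Minkowski sum. The ancestor $A(X)$ of $X$ in the Radial Poisson Tree with parameter $\rho$ is the (almost surely unique) point of $\mathrm{Cyl}(X,\rho)\cap(\mathcal N\setminus B(O,\rho))$ with the largest Euclidean norm if this set is nonempty, and $A(X)=O$ otherwise. For $r>0$ let $X_0=(r,0)$ and $X_{k+1}=A(X_k)$; almost surely there is a first index $h(r)$ with $X_{h(r)}=O$. Let $$\Delta_r=\max_{0\le k\le h(r)}|X_k(2)|$$ be the maximal deviation from the horizontal axis of the branch $X_0,X_1,\dots,X_{h(r)}=O$, where $X_k(2)$ is the ordinate of $X_k$. Then, for every $\varepsilon>0$ and every $n\in\mathbb N$, $$\mathbb P\big(\Delta_r\ge r^{\frac12+\varepsilon}\big)=\mathcal O(r^{-n})\qquad\text{as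 } r\to\infty.$$ -/

import Mathlib

open MeasureTheory ProbabilityTheory
open scoped Pointwise

namespace RadialPoissonTree

noncomputable section

/-- The random set `N` of points of the plane (`ℝ²` identified with `ℂ`, with Lebesgue measure
`volume`) is a homogeneous Poisson point process with intensity `1` under `P`. -/
structure IsUnitPoissonProcess {Ω : Type*} [MeasurableSpace Ω] (P : Measure Ω)
    (N : Ω → Set ℂ) : Prop where
  /-- almost surely, every ball contains finitely many points -/
  locallyFinite : ∀ᵐ ω ∂P, ∀ R : ℝ, (N ω ∩ Metric.ball 0 R).Finite
  /-- the number of points in a Borel set is a random variable -/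
  measurable_count : ∀ B : Set ℂ, MeasurableSet B → Measurable fun ω => (N ω ∩ B).encard
  /-- the number of points in `B` is Poisson distributed with parameter the area of `B` -/
  map_count : ∀ B : Set ℂ, MeasurableSet B → volume B ≠ ⊤ →
    P.map (fun ω => (N ω ∩ B).encard) =
      (poissonMeasure (volume B).toNNReal).map (fun k : ℕ => (k : ℕ∞))
  /-- the numbers of points in pairwise disjoint Borel sets are independent -/
  indep_count : ∀ (m : ℕ) (B : Fin m → Set ℂ), (∀ i, MeasurableSet (B i)) →
    Pairwise (Function.onFun Disjoint B) →
    iIndepFun (fun (i : Fin m) (ω : Ω) => (N ω ∩ B i).encard) P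

/-- `Cyl(X, ρ) = ([O ; X] ⊕ B(O, ρ)) ∩ B(O, |X|)`. -/
def cyl (ρ : ℝ) (X : ℂ) : Set ℂ :=
  (segment ℝ 0 X + Metric.ball 0 ρ) ∩ Metric.ball 0 ‖X‖

open Classical in
/-- The ancestor `A(X)`, for the vertex set `V`: a point of `Cyl(X, ρ) ∩ V` with the largest
Euclidean norm, and the origin if `Cyl(X, ρ) ∩ V` is empty. For a locally finite `V` the maximum
is attained as soon as `Cyl(X, ρ) ∩ V` is nonempty; for a Poisson process it is almost surely
attained at only one point. -/
def ancestor (ρ : ℝ) (V : Set ℂ) (X : ℂ) : ℂ :=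
  if h : ∃ Y ∈ cyl ρ X ∩ V, ∀ Z ∈ cyl ρ X ∩ V, ‖Z‖ ≤ ‖Y‖ then h.choose else 0

/-- The successive ancestors `X₀ = (r, 0), X₁, X₂, …` in the tree with the points of `N` outside
of `B(O, ρ)` as its vertices, continued by `O` once the origin is reached. -/
def branch (ρ : ℝ) (N : Set ℂ) (r : ℝ) (k : ℕ) : ℂ :=
  (ancestor ρ (N \ Metric.ball 0 ρ))^[k] (r : ℂ)

/-- The maximal deviation `Δ_r` of the branch from `(r, 0)` to `O` with respect to the horizontal
axis. The branch stays at `O` from the step `h(r)` on at which it reaches `O`, so that this is the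
maximum over `0 ≤ k ≤ h(r)`: see `maxDeviation_eq`. -/
def maxDeviation (ρ : ℝ) (N : Set ℂ) (r : ℝ) : ℝ :=
  ⨆ k : ℕ, |(branch ρ N r k).im|

theorem ancestor_zero (ρ : ℝ) (V : Set ℂ) : ancestor ρ V 0 = 0 := by
  unfold ancestor
  rw [dif_neg]
  rintro ⟨Y, hY, -⟩
  simp [cyl] at hY

theorem maxDeviation_eq (ρ : ℝ) (N : Set ℂ) (r : ℝ) (h : ℕ) (hh : branch ρ N r h = 0) :
    maxDeviation ρ N r =
      (Finset.range (h + 1)).sup' ⟨0, by simp⟩ fun k => |(branch ρ N r k).im| := by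
  have key : ∀ k, |(branch ρ N r k).im| ≤
      (Finset.range (h + 1)).sup' ⟨0, by simp⟩ fun k => |(branch ρ N r k).im| := by
    intro k
    rcases le_or_gt k h with hk | hk
    · exact Finset.le_sup' (fun k => |(branch ρ N r k).im|) (by simp; omega)
    · have hz : branch ρ N r k = 0 := by
        obtain ⟨j, rfl⟩ := Nat.exists_eq_add_of_lt hk
        rw [show h + j + 1 = (j + 1) + h by omega]
        unfold branch at hh ⊢
        rw [Function.iterate_add_apply, hh]
        exact Function.iterate_fixed (ancestor_zero _ _) _
      rw [hz, ← hh]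
      exact Finset.le_sup' (fun k => |(branch ρ N r k).im|) (by simp)
  apply le_antisymm (ciSup_le key)
  apply Finset.sup'_le
  intro k _
  exact le_ciSup (f := fun k => |(branch ρ N r k).im|) ⟨_, by rintro _ ⟨k, rfl⟩; exact key k⟩ k

end

end RadialPoissonTree

/-!
The points of the process in the disc inside the current vertex of a branch are independent of the
part of the branch explored so far, since all the regions seen before lie farther from the origin.
Moreover the cylinder of a vertex is symmetric under the reflection at the line through that vertex
and the origin, so that the angle by which the branch turns at a vertex is symmetric. At distance
`s` from the origin this angle is of order `ρ / s`, and about one turn occurs per unit of distance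
covered; hence the angle of the branch at distance `s` is a martingale with variance of order
`∫ du / u²` over `u` between `s` and `r`, which is at most `1 / s`. The deviation from the axis
there is of order `s · s ^ (-1/2) ≤ √r`.

Strong Markov arguments are avoided by cutting the annulus between the radii `√r` and `r` into at
least `r ^ (n + 4)` thin shells of equal width. The counts in distinct shells are independent, and
with probability `1 - O(r ^ (-n))` no shell contains two points. On this event the branch coincides
with a walk that reads off in each shell its sole point, if there is one (`branch_eq_walk`). The
sole points are independent (`IsUnitPoissonProcess.iIndepFun_solePoint`), and their laws are
multiples of the area, up to an atom at the junk value `0`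
(`IsUnitPoissonProcess.map_solePoint_apply`). By the reflection symmetry, the exponential moment
`E exp (l Θ)` of the angle is multiplied in the shell between `a` and `b` by a factor of at most
`1 + O(l² (b - a) / a²)` (`lintegral_exp_turn_le`), and these factors telescope to
`exp (O(l² / s))` at the level `s` (`lintegral_exp_walk_le`). Markov's inequality with `l = √s`
bounds the probability that the deviation exceeds `r ^ (1/2 + ε)` at the level `s` by a multiple of
`exp (-r ^ ε / 4)`, and a union bound over the shells gives the claim. Vertices of norm below `√r`
cannot deviate by more than `√r`.
-/

/-! ### The point of a Poisson process in a set of small area -/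

namespace RadialPoissonTree

section Counts

variable {Ω : Type*} [MeasurableSpace Ω] {P : Measure Ω} {N : Ω → Set ℂ}

theorem IsUnitPoissonProcess.measure_count_eq (hN : IsUnitPoissonProcess P N) {B : Set ℂ}
    (hB : MeasurableSet B) (hv : volume B ≠ ⊤) (k : ℕ) :
    P {ω | (N ω ∩ B).encard = k} = ENNReal.ofReal
      (Real.exp (-(volume B).toReal) * (volume B).toReal ^ k / k.factorial) := by
  have h := congrArg (fun μ : Measure ℕ∞ => μ {(k : ℕ∞)}) (hN.map_count B hB hv)
  rw [Measure.map_apply (hN.measurable_count B hB) (by measurability),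
    Measure.map_apply (by measurability) (by measurability)] at h
  have e : (fun k : ℕ => (k : ℕ∞)) ⁻¹' {(k : ℕ∞)} = {k} := by
    ext; simp
  rw [e, poissonMeasure_singleton] at h
  exact h

theorem IsUnitPoissonProcess.iIndepFun_count (hN : IsUnitPoissonProcess P N) {ι : Type*} [Fintype ι]
    {B : ι → Set ℂ} (hB : ∀ i, MeasurableSet (B i))
    (hd : Pairwise (Function.onFun Disjoint B)) :
    iIndepFun (fun (i : ι) (ω : Ω) => (N ω ∩ B i).encard) P := by
  have h := hN.indep_count (Fintype.card ι) (fun i => B ((Fintype.equivFin ι).symm i))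
    (fun i => hB _) (fun i j hij => hd (fun h => hij ((Fintype.equivFin ι).symm.injective h)))
  exact h.of_precomp (g := (Fintype.equivFin ι).symm) (Equiv.surjective _)

theorem IsUnitPoissonProcess.measure_one_lt_count_le [IsProbabilityMeasure P]
    (hN : IsUnitPoissonProcess P N)
    {B : Set ℂ} (hB : MeasurableSet B) (hv : volume B ≠ ⊤) :
    P {ω | 1 < (N ω ∩ B).encard} ≤ ENNReal.ofReal ((volume B).toReal ^ 2) := by
  set v := (volume B).toReal with hvdef
  have hv0 : 0 ≤ v := ENNReal.toReal_nonneg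
  have hm := hN.measurable_count B hB
  have h0 := hN.measure_count_eq hB hv 0
  have h1 := hN.measure_count_eq hB hv 1
  rw [← hvdef] at h0 h1
  have hm0 : MeasurableSet {ω | (N ω ∩ B).encard = (0 : ℕ)} :=
    hm (MeasurableSet.of_discrete (s := {((0 : ℕ) : ℕ∞)}))
  have hm1 : MeasurableSet {ω | (N ω ∩ B).encard = (1 : ℕ)} :=
    hm (MeasurableSet.of_discrete (s := {((1 : ℕ) : ℕ∞)}))
  have e : {ω | 1 < (N ω ∩ B).encard} =
      ({ω | (N ω ∩ B).encard = (0 : ℕ)} ∪ {ω | (N ω ∩ B).encard = (1 : ℕ)})ᶜ := by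
    ext ω
    simp only [Set.mem_ofPred_eq, Set.mem_compl_iff, Set.mem_union]
    rw [← not_le, Set.encard_le_one_iff_eq]
    simp [Set.encard_eq_one]
  rw [e, prob_compl_eq_one_sub (hm0.union hm1), measure_union _ hm1, h0, h1,
    ← ENNReal.ofReal_add (by positivity) (by positivity), ← ENNReal.ofReal_one,
    ← ENNReal.ofReal_sub _ (by positivity)]
  · apply ENNReal.ofReal_le_ofReal
    have := Real.add_one_le_exp (-v)
    simp
    nlinarith
  · rw [Set.disjoint_left]
    intro ω h h'
    simp only [Set.mem_ofPred_eq] at h h'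
    rw [h] at h'
    simp at h'

open Classical in
/-- The element of a one-element set, and the junk value `0` for any other set. -/
noncomputable def solePoint (A : Set ℂ) : ℂ := if h : ∃ y, A = {y} then h.choose else 0

theorem solePoint_singleton (y : ℂ) : solePoint {y} = y := by
  have h : ∃ z, ({y} : Set ℂ) = {z} := ⟨y, rfl⟩
  rw [solePoint, dif_pos h]
  exact (Set.singleton_injective h.choose_spec).symm

theorem solePoint_of_encard_ne_one {A : Set ℂ} (h : A.encard ≠ 1) : solePoint A = 0 := by
  rw [solePoint, dif_neg]
  rwa [ne_eq, Set.encard_eq_one] at h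

theorem solePoint_mem_iff {A S B : Set ℂ} (hB : (0 : ℂ) ∉ B) :
    solePoint (A ∩ S) ∈ B ↔ (A ∩ (S ∩ B)).encard = 1 ∧ (A ∩ (S \ B)).encard = 0 := by
  constructor
  · intro h
    have h1 : (A ∩ S).encard = 1 := by
      by_contra hne
      rw [solePoint_of_encard_ne_one hne] at h
      exact hB h
    obtain ⟨y, hy⟩ := Set.encard_eq_one.1 h1
    rw [hy, solePoint_singleton] at h
    rw [← Set.inter_assoc, ← Set.inter_sdiff_assoc, hy, Set.inter_eq_left.2 (by simpa using h),
      Set.sdiff_eq_empty.2 (by simpa using h)]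
    simp
  · rintro ⟨h1, h0⟩
    obtain ⟨y, hy⟩ := Set.encard_eq_one.1 h1
    rw [Set.encard_eq_zero] at h0
    have : A ∩ S = {y} := by
      rw [← hy, ← Set.union_empty (A ∩ (S ∩ B)), ← h0, ← Set.inter_union_distrib_left,
        Set.inter_union_sdiff]
    rw [this, solePoint_singleton]
    have : y ∈ A ∩ (S ∩ B) := by rw [hy]; rfl
    exact this.2.2

/-- Preimages of sets that contain the junk value `0` of `solePoint` need not be considered. -/
theorem measurable_of_measurableSet_preimage_of_zero_notMem {Ω : Type*}
    {_ : MeasurableSpace Ω} {f : Ω → ℂ}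
    (h : ∀ B : Set ℂ, MeasurableSet B → (0 : ℂ) ∉ B → MeasurableSet (f ⁻¹' B)) :
    Measurable f := by
  intro B hB
  by_cases h0 : (0 : ℂ) ∈ B
  · rw [← compl_compl B, Set.preimage_compl]
    exact (h _ hB.compl (by simpa using h0)).compl
  · exact h B hB h0

theorem preimage_solePoint {Ω : Type*} {N : Ω → Set ℂ} {S B : Set ℂ} (hB : (0 : ℂ) ∉ B) :
    (fun ω => solePoint (N ω ∩ S)) ⁻¹' B =
      {ω | (N ω ∩ (S ∩ B)).encard = (1 : ℕ)} ∩ {ω | (N ω ∩ (S \ B)).encard = (0 : ℕ)} := by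
  ext ω
  simpa using solePoint_mem_iff hB

theorem IsUnitPoissonProcess.measurable_solePoint (hN : IsUnitPoissonProcess P N) {S : Set ℂ}
    (hS : MeasurableSet S) : Measurable fun ω => solePoint (N ω ∩ S) := by
  apply measurable_of_measurableSet_preimage_of_zero_notMem
  intro B hB h0
  rw [preimage_solePoint h0]
  exact (hN.measurable_count _ (hS.inter hB) (MeasurableSet.of_discrete
    (s := {((1 : ℕ) : ℕ∞)}))).inter (hN.measurable_count _ (hS.diff hB)
      (MeasurableSet.of_discrete (s := {((0 : ℕ) : ℕ∞)})))

/-- Splitting each `S i` into `S i ∩ B i` and `S i \ B i`, the events that the former holds one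
point and the latter none are determined by counts in disjoint sets. -/
theorem IsUnitPoissonProcess.measure_iInter_preimage_solePoint (hN : IsUnitPoissonProcess P N)
    {ι : Type*} [Fintype ι] {S B : ι → Set ℂ} (hS : ∀ i, MeasurableSet (S i))
    (hB : ∀ i, MeasurableSet (B i)) (hd : Pairwise (Function.onFun Disjoint S))
    (h0 : ∀ i, (0 : ℂ) ∉ B i) :
    P (⋂ i, (fun ω => solePoint (N ω ∩ S i)) ⁻¹' B i) =
      ∏ i, P {ω | (N ω ∩ (S i ∩ B i)).encard = (1 : ℕ)} *
        P {ω | (N ω ∩ (S i \ B i)).encard = (0 : ℕ)} := by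
  let C : ι × Bool → Set ℂ := fun x => if x.2 then S x.1 ∩ B x.1 else S x.1 \ B x.1
  let k : ι × Bool → ℕ := fun x => if x.2 then 1 else 0
  have hC : ∀ x, MeasurableSet (C x) := by
    rintro ⟨i, b⟩
    cases b
    · exact (hS i).diff (hB i)
    · exact (hS i).inter (hB i)
  have hCS : ∀ x, C x ⊆ S x.1 := by
    rintro ⟨i, b⟩
    cases b
    · exact Set.sdiff_subset
    · exact Set.inter_subset_left
  have hCd : Pairwise (Function.onFun Disjoint C) := by
    rintro ⟨i, b⟩ ⟨j, c⟩ hne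
    by_cases hij : i = j
    · subst hij
      cases b <;> cases c
      · simp at hne
      · exact Set.disjoint_sdiff_inter
      · exact Set.disjoint_sdiff_inter.symm
      · simp at hne
    · exact (hd hij).mono (hCS _) (hCS _)
  have h := (hN.iIndepFun_count hC hCd).meas_iInter
    (s := fun x => {ω | (N ω ∩ C x).encard = (k x : ℕ)})
    (fun x => ⟨{(k x : ℕ∞)}, MeasurableSet.of_discrete, rfl⟩)
  rw [Fintype.prod_prod_type] at h
  simp only [Fintype.prod_bool] at h
  rw [show (⋂ i, (fun ω => solePoint (N ω ∩ S i)) ⁻¹' B i) =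
    ⋂ x, {ω | (N ω ∩ C x).encard = (k x : ℕ)} from ?_, h]
  · rfl
  · ext ω
    simp only [preimage_solePoint (h0 _), Set.mem_iInter, Prod.forall, Bool.forall_bool]
    exact forall_congr' fun i => And.comm

theorem IsUnitPoissonProcess.measure_preimage_solePoint (hN : IsUnitPoissonProcess P N)
    {S B : Set ℂ} (hS : MeasurableSet S) (hB : MeasurableSet B) (h0 : (0 : ℂ) ∉ B) :
    P ((fun ω => solePoint (N ω ∩ S)) ⁻¹' B) = P {ω | (N ω ∩ (S ∩ B)).encard = (1 : ℕ)} *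
        P {ω | (N ω ∩ (S \ B)).encard = (0 : ℕ)} := by
  have h := hN.measure_iInter_preimage_solePoint (ι := Unit) (S := fun _ => S) (B := fun _ => B)
    (fun _ => hS) (fun _ => hB) (fun i j hij => (hij rfl).elim) (fun _ => h0)
  simpa [Set.iInter_const] using h

theorem IsUnitPoissonProcess.iIndepFun_solePoint (hN : IsUnitPoissonProcess P N) {ι : Type*}
    {S : ι → Set ℂ} (hS : ∀ i, MeasurableSet (S i))
    (hd : Pairwise (Function.onFun Disjoint S)) :
    iIndepFun (fun i ω => solePoint (N ω ∩ S i)) P := by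
  rw [iIndepFun_iff_iIndep]
  -- The preimages of Borel sets that avoid the junk value `0` are a generating π-system.
  refine iIndepSets.iIndep (h_le := fun i => (hN.measurable_solePoint (hS i)).comap_le)
    (π := fun i => {A | ∃ B : Set ℂ, MeasurableSet B ∧ (0 : ℂ) ∉ B ∧
      (fun ω => solePoint (N ω ∩ S i)) ⁻¹' B = A}) (h_pi := ?_) (h_generate := ?_) (h_ind := ?_)
  · rintro i _ ⟨B, hB, h0, rfl⟩ _ ⟨C, hC, -, rfl⟩ -
    exact ⟨B ∩ C, hB.inter hC, fun h => h0 h.1, rfl⟩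
  · intro i
    apply le_antisymm
    · rw [← measurable_iff_comap_le]
      apply measurable_of_measurableSet_preimage_of_zero_notMem
      intro B hB h0
      exact MeasurableSpace.measurableSet_generateFrom ⟨B, hB, h0, rfl⟩
    · apply MeasurableSpace.generateFrom_le
      rintro _ ⟨B, hB, -, rfl⟩
      exact ⟨B, hB, rfl⟩
  · rw [iIndepSets_iff]
    intro s f hf
    choose! B hB h0 hBf using hf
    have h := hN.measure_iInter_preimage_solePoint (ι := s) (S := fun i => S i)
      (B := fun i => B i) (fun i => hS i) (fun i => hB i i.2)
      (fun i j hij => hd (fun h => hij (Subtype.ext h))) (fun i => h0 i i.2)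
    rw [Finset.prod_coe_sort s (fun i => P {ω | (N ω ∩ (S i ∩ B i)).encard = (1 : ℕ)} *
        P {ω | (N ω ∩ (S i \ B i)).encard = (0 : ℕ)})] at h
    rw [← Finset.prod_congr rfl (fun i hi => hBf i hi ▸
      (hN.measure_preimage_solePoint (hS i) (hB i hi) (h0 i hi)).symm), ← h]
    congr 1
    ext ω
    simp only [Set.mem_iInter, Subtype.forall]
    exact forall₂_congr fun i hi => by rw [← hBf i hi]

theorem IsUnitPoissonProcess.map_solePoint_apply (hN : IsUnitPoissonProcess P N)
    {S B : Set ℂ} (hS : MeasurableSet S) (hv : volume S ≠ ⊤) (hB : MeasurableSet B)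
    (h0 : (0 : ℂ) ∉ B) :
    P.map (fun ω => solePoint (N ω ∩ S)) B =
      ENNReal.ofReal (Real.exp (-(volume S).toReal)) * volume (S ∩ B) := by
  have hv1 : volume (S ∩ B) ≠ ⊤ := measure_ne_top_of_subset Set.inter_subset_left hv
  have hv2 : volume (S \ B) ≠ ⊤ := measure_ne_top_of_subset Set.sdiff_subset hv
  rw [Measure.map_apply (hN.measurable_solePoint hS) hB, hN.measure_preimage_solePoint hS hB h0,
    hN.measure_count_eq (hS.inter hB) hv1, hN.measure_count_eq (hS.diff hB) hv2,
    ← ENNReal.ofReal_mul (by positivity), ← measure_inter_add_sdiff S hB,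
    ENNReal.toReal_add hv1 hv2]
  nth_rewrite 4 [← ENNReal.ofReal_toReal hv1]
  rw [← ENNReal.ofReal_mul (by positivity), neg_add, Real.exp_add]
  congr 1
  simp
  ring

end Counts

end RadialPoissonTree

/-! ### Angles and areas in the cylinder -/

namespace RadialPoissonTree

section Geometry

theorem mem_cyl_iff {ρ : ℝ} {z y : ℂ} :
    y ∈ cyl ρ z ↔ (∃ t ∈ Set.Icc (0 : ℝ) 1, ‖y - t * z‖ < ρ) ∧ ‖y‖ < ‖z‖ := by
  rw [cyl, Set.mem_inter_iff, mem_ball_zero_iff, segment_eq_image]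
  refine and_congr_left fun _ => ?_
  simp only [Set.mem_add, Set.mem_image, mem_ball_zero_iff]
  constructor
  · rintro ⟨_, ⟨t, ht, rfl⟩, v, hv, rfl⟩
    exact ⟨t, ht, by simpa using hv⟩
  · rintro ⟨t, ht, h⟩
    exact ⟨t * z, ⟨t, ht, by simp⟩, y - t * z, h, by ring⟩

theorem norm_lt_of_mem_cyl {ρ : ℝ} {z y : ℂ} (h : y ∈ cyl ρ z) : ‖y‖ < ‖z‖ := (mem_cyl_iff.1 h).2

theorem isOpen_setOf_mem_cyl (ρ : ℝ) : IsOpen {p : ℂ × ℂ | p.2 ∈ cyl ρ p.1} := by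
  have : {p : ℂ × ℂ | p.2 ∈ cyl ρ p.1} =
      (⋃ t ∈ Set.Icc (0 : ℝ) 1, {p : ℂ × ℂ | ‖p.2 - t * p.1‖ < ρ}) ∩ {p | ‖p.2‖ < ‖p.1‖} := by
    ext p
    simp only [Set.mem_ofPred_eq, mem_cyl_iff, Set.mem_inter_iff, Set.mem_iUnion, exists_prop]
  rw [this]
  refine (isOpen_biUnion fun t _ => isOpen_lt ?_ ?_).inter (isOpen_lt ?_ ?_) <;> fun_prop

theorem ne_zero_of_mem_cyl {ρ : ℝ} {z y : ℂ} (h : y ∈ cyl ρ z) : z ≠ 0 := by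
  have := norm_lt_of_mem_cyl h
  exact norm_pos_iff.1 ((norm_nonneg _).trans_lt this)

theorem exists_norm_div_sub_lt {ρ : ℝ} {z y : ℂ} (h : y ∈ cyl ρ z) :
    ∃ t ∈ Set.Icc (0 : ℝ) 1, ‖y / z - t‖ < ρ / ‖z‖ := by
  have hz := ne_zero_of_mem_cyl h
  obtain ⟨⟨t, ht, hlt⟩, -⟩ := mem_cyl_iff.1 h
  refine ⟨t, ht, ?_⟩
  rw [show y / z - t = (y - t * z) / z by field_simp, norm_div]
  exact div_lt_div_of_pos_right hlt (norm_pos_iff.2 hz)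

/-- A point of the cylinder not too close to the origin is seen from there at an acute angle
to `z`. -/
theorem re_div_pos_of_mem_cyl {ρ : ℝ} {z y : ℂ} (h : y ∈ cyl ρ z) (hy : 2 * ρ ≤ ‖y‖) :
    0 < (y / z).re := by
  have hz := norm_pos_iff.2 (ne_zero_of_mem_cyl h)
  obtain ⟨t, ht, hlt⟩ := exists_norm_div_sub_lt h
  have h1 : 2 * (ρ / ‖z‖) ≤ ‖y / z‖ := by
    rw [norm_div, ← mul_div_assoc]
    exact div_le_div_of_nonneg_right hy hz.le
  have h2 : ‖y / z‖ ≤ ‖y / z - t‖ + t := by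
    have := norm_add_le (y / z - t) t
    rwa [sub_add_cancel, Complex.norm_real, Real.norm_eq_abs, abs_of_nonneg ht.1] at this
  have h3 := (abs_le.1 (Complex.abs_re_le_norm (y / z - t))).1
  simp only [Complex.sub_re, Complex.ofReal_re] at h3
  linarith

/-- The sine of the angle is at most `ρ / ‖y‖`, since `y` has distance less than `ρ` from the segment
between `0` and `z`; the angle itself is at most `π / 2` times that. -/
theorem abs_arg_div_le_of_mem_cyl {ρ : ℝ} (hρ : 0 < ρ) {z y : ℂ} (h : y ∈ cyl ρ z)
    (hy : 2 * ρ ≤ ‖y‖) : |(y / z).arg| ≤ Real.pi / 2 * (ρ / ‖y‖) := by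
  have hz := norm_pos_iff.2 (ne_zero_of_mem_cyl h)
  have hy0 : 0 < ‖y‖ := by linarith
  have hre := re_div_pos_of_mem_cyl h hy
  obtain ⟨t, ht, hlt⟩ := exists_norm_div_sub_lt h
  have him : |(y / z).im| < ρ / ‖z‖ := by
    have := Complex.abs_im_le_norm (y / z - t)
    simp only [Complex.sub_im, Complex.ofReal_im, sub_zero] at this
    linarith
  have hsin : Real.sin |(y / z).arg| ≤ ρ / ‖y‖ := by
    have e : |Real.sin (y / z).arg| = |(y / z).im| * (‖z‖ / ‖y‖) := by
      rw [Complex.sin_arg, abs_div, abs_norm, norm_div]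
      field_simp
    have h1 : Real.sin |(y / z).arg| ≤ |Real.sin (y / z).arg| := by
      rcases abs_choice (y / z).arg with h | h <;> rw [h]
      · exact le_abs_self _
      · rw [Real.sin_neg]; exact neg_le_abs _
    calc _ ≤ _ := h1
      _ = _ := e
      _ ≤ ρ / ‖z‖ * (‖z‖ / ‖y‖) := by gcongr
      _ = _ := by field_simp
  have hpi : |(y / z).arg| ≤ Real.pi / 2 := Complex.abs_arg_le_pi_div_two_iff.2 hre.le
  have := Real.mul_le_sin (abs_nonneg _) hpi
  have h2 : 2 / Real.pi * |(y / z).arg| ≤ ρ / ‖y‖ := this.trans hsin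
  calc |(y / z).arg| = Real.pi / 2 * (2 / Real.pi * |(y / z).arg|) := by
        field_simp
    _ ≤ _ := by gcongr

/-- The half-open annulus of inner radius `s` and outer radius `t`. -/
def shell (s t : ℝ) : Set ℂ := {z | s ≤ ‖z‖ ∧ ‖z‖ < t}

theorem measurableSet_shell (s t : ℝ) : MeasurableSet (shell s t) :=
  (measurableSet_le measurable_const measurable_norm).inter
    (measurableSet_lt measurable_norm measurable_const)

theorem volume_shell {s t : ℝ} (hs : 0 ≤ s) (hst : s ≤ t) :
    volume (shell s t) = ENNReal.ofReal (Real.pi * (t ^ 2 - s ^ 2)) := by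
  have e : shell s t = Metric.ball (0 : ℂ) t \ Metric.ball 0 s := by
    ext z
    simp [shell, and_comm]
  have hfin : volume (Metric.ball (0 : ℂ) s) ≠ ⊤ := measure_ball_lt_top.ne
  rw [e, measure_sdiff (Metric.ball_subset_ball hst) measurableSet_ball.nullMeasurableSet hfin,
    Complex.volume_ball, Complex.volume_ball, ← ENNReal.ofReal_pow hs,
    ← ENNReal.ofReal_pow (hs.trans hst), ← ENNReal.ofReal_coe_nnreal,
    ← ENNReal.ofReal_mul (by positivity), ← ENNReal.ofReal_mul (by positivity),
    ← ENNReal.ofReal_sub _ (by positivity)]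
  congr 1
  simp
  ring

/-- In polar coordinates, with the Jacobian bounded by the outer radius. -/
theorem volume_sector_le {s t α : ℝ} :
    volume {w : ℂ | w ∈ shell s t ∧ |w.arg| ≤ α} ≤
      ENNReal.ofReal t * (ENNReal.ofReal (t - s) * ENNReal.ofReal (2 * α)) := by
  have hm : MeasurableSet {w : ℂ | w ∈ shell s t ∧ |w.arg| ≤ α} :=
    (measurableSet_shell s t).inter
      (measurableSet_le Complex.measurable_arg.abs measurable_const)
  rw [← lintegral_indicator_one hm, ← Complex.lintegral_comp_polarCoord_symm]
  calc _ ≤ ∫⁻ p in polarCoord.target, (Set.Icc s t ×ˢ Set.Icc (-α) α).indicator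
        (fun _ => ENNReal.ofReal t) p := by
        apply setLIntegral_mono' polarCoord.open_target.measurableSet
        rintro ⟨a, b⟩ ⟨ha, hb⟩
        simp only [Set.mem_Ioi] at ha
        by_cases h : Complex.polarCoord.symm (a, b) ∈ {w : ℂ | w ∈ shell s t ∧ |w.arg| ≤ α}
        · have h1 := h.1
          have h2 := h.2
          rw [shell, Set.mem_ofPred_eq, Complex.norm_polarCoord_symm, abs_of_pos ha] at h1
          rw [Complex.polarCoord_symm_apply] at h2
          simp only at h2 h1
          rw [Complex.ofReal_cos, Complex.ofReal_sin,
            Complex.arg_mul_cos_add_sin_mul_I ha ⟨hb.1, hb.2.le⟩] at h2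
          rw [Set.indicator_of_mem h, Set.indicator_of_mem]
          · simpa using ENNReal.ofReal_le_ofReal h1.2.le
          · exact ⟨⟨h1.1, h1.2.le⟩, abs_le.1 h2⟩
        · rw [Set.indicator_of_notMem h]
          simp
    _ ≤ ∫⁻ p, (Set.Icc s t ×ˢ Set.Icc (-α) α).indicator (fun _ => ENNReal.ofReal t) p :=
        setLIntegral_le_lintegral _ _
    _ = _ := by
        rw [lintegral_indicator_const (measurableSet_Icc.prod measurableSet_Icc),
          Measure.volume_eq_prod, Measure.prod_prod, Real.volume_Icc, Real.volume_Icc]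
        congr 3
        ring

/-- The reflection of the plane at the line through `0` and `z`. -/
noncomputable def reflect (z : ℂ) (y : ℂ) : ℂ := z * (starRingEnd ℂ) (y / z)

theorem reflect_div {z y : ℂ} (hz : z ≠ 0) : reflect z y / z = (starRingEnd ℂ) (y / z) := by
  rw [reflect, mul_div_cancel_left₀ _ hz]

theorem norm_reflect {z y : ℂ} (hz : z ≠ 0) : ‖reflect z y‖ = ‖y‖ := by
  have := norm_pos_iff.2 hz
  rw [reflect, norm_mul, Complex.norm_conj, norm_div]
  field_simp

theorem reflect_mem_cyl {ρ : ℝ} {z y : ℂ} (h : y ∈ cyl ρ z) : reflect z y ∈ cyl ρ z := by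
  have hz := ne_zero_of_mem_cyl h
  rw [mem_cyl_iff] at h ⊢
  obtain ⟨⟨t, ht, h1⟩, h2⟩ := h
  refine ⟨⟨t, ht, ?_⟩, by rwa [norm_reflect hz]⟩
  rwa [show reflect z y - t * z = reflect z (y - t * z) by
    simp only [reflect, sub_div, mul_div_cancel_right₀ _ hz, map_sub, Complex.conj_ofReal]
    ring, norm_reflect hz]

theorem reflect_reflect {z y : ℂ} (hz : z ≠ 0) : reflect z (reflect z y) = y := by
  rw [reflect, reflect_div hz, Complex.conj_conj, mul_div_cancel₀ _ hz]

theorem reflect_mem_cyl_iff {ρ : ℝ} {z y : ℂ} (hz : z ≠ 0) :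
    reflect z y ∈ cyl ρ z ↔ y ∈ cyl ρ z :=
  ⟨fun h => by simpa only [reflect_reflect hz] using reflect_mem_cyl h, reflect_mem_cyl⟩

theorem measurePreserving_mul_of_norm_eq_one {c : ℂ} (hc : ‖c‖ = 1) :
    MeasurePreserving (fun y : ℂ => c * y) volume volume :=
  (rotation ⟨c, mem_sphere_zero_iff_norm.2 hc⟩).measurePreserving

theorem measurePreserving_reflect {z : ℂ} (hz : z ≠ 0) :
    MeasurePreserving (reflect z) volume volume := by
  have h := (measurePreserving_mul_of_norm_eq_one (c := z / (starRingEnd ℂ) z)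
    (by rw [norm_div, Complex.norm_conj, div_self (norm_ne_zero_iff.2 hz)])).comp
    Complex.conjLIE.measurePreserving
  have e : reflect z = (fun y => z / (starRingEnd ℂ) z * y) ∘ Complex.conjLIE := by
    funext y
    simp [reflect, div_mul_eq_mul_div, mul_div_assoc]
  rwa [e]

theorem volume_cyl_inter_shell_le {ρ : ℝ} (hρ : 0 < ρ) {s t : ℝ} (hs : 2 * ρ ≤ s)
    (hts : t ≤ 2 * s) (z : ℂ) :
    volume (cyl ρ z ∩ shell s t) ≤ ENNReal.ofReal (2 * Real.pi * ρ * (t - s)) := by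
  by_cases hst : t ≤ s
  · have : shell s t = ∅ := by
      ext w
      simp only [shell, Set.mem_ofPred_eq, Set.mem_empty_iff_false, iff_false]
      rintro ⟨h1, h2⟩
      linarith
    simp [this]
  push Not at hst
  have hs0 : 0 < s := by linarith
  by_cases hz : z = 0
  · have : cyl ρ z = ∅ := Set.eq_empty_of_forall_notMem fun y hy => ne_zero_of_mem_cyl hy hz
    simp [this]
  have hz' := norm_pos_iff.2 hz
  have hsub : cyl ρ z ∩ shell s t ⊆ (fun y : ℂ => (‖z‖ / z) * y) ⁻¹'
      {w : ℂ | w ∈ shell s t ∧ |w.arg| ≤ Real.pi / 2 * (ρ / s)} := by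
    rintro y ⟨hy, hys⟩
    have hn : ‖(‖z‖ / z) * y‖ = ‖y‖ := by
      rw [norm_mul, norm_div, Complex.norm_real, norm_norm, div_self hz'.ne', one_mul]
    refine ⟨by rw [shell, Set.mem_ofPred_eq, hn]; exact hys, ?_⟩
    beta_reduce
    rw [show (‖z‖ / z) * y = (‖z‖ : ℝ) * (y / z) by ring, Complex.arg_real_mul _ hz']
    refine (abs_arg_div_le_of_mem_cyl hρ hy (hs.trans hys.1)).trans ?_
    have := hys.1
    gcongr
  have hmp := measurePreserving_mul_of_norm_eq_one (c := ‖z‖ / z)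
    (by rw [norm_div, Complex.norm_real, norm_norm, div_self hz'.ne'])
  have hm : MeasurableSet {w : ℂ | w ∈ shell s t ∧ |w.arg| ≤ Real.pi / 2 * (ρ / s)} :=
    (measurableSet_shell s t).inter
      (measurableSet_le Complex.measurable_arg.abs measurable_const)
  calc _ ≤ _ := measure_mono hsub
    _ = _ := hmp.measure_preimage hm.nullMeasurableSet
    _ ≤ _ := volume_sector_le
    _ ≤ _ := by
      rw [← ENNReal.ofReal_mul (by linarith), ← ENNReal.ofReal_mul (by linarith)]
      apply ENNReal.ofReal_le_ofReal
      rw [show t * ((t - s) * (2 * (Real.pi / 2 * (ρ / s)))) =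
        Real.pi * ρ * (t - s) * (t / s) by ring,
        show 2 * Real.pi * ρ * (t - s) = Real.pi * ρ * (t - s) * 2 by ring]
      have : t / s ≤ 2 := by rwa [div_le_iff₀ hs0]
      have : 0 ≤ t - s := by linarith
      gcongr

end Geometry

end RadialPoissonTree

/-! ### One step of the walk -/

namespace RadialPoissonTree

section Step

open Classical in
/-- The signed angle by which the branch turns when it goes from `z` to the point `y`, provided
that `y` lies in the part of the cylinder of `z` in `S`; otherwise the branch does not move. -/
noncomputable def turn (ρ : ℝ) (S : Set ℂ) (z y : ℂ) : ℝ :=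
  if y ∈ cyl ρ z ∩ S then (y / z).arg else 0

open Classical in
/-- The vertex that follows `z` if `y` is the only point in `S`. -/
noncomputable def next (ρ : ℝ) (S : Set ℂ) (z y : ℂ) : ℂ := if y ∈ cyl ρ z ∩ S then y else z

theorem measurableSet_setOf_mem_cyl_inter {α : Type*} [MeasurableSpace α] (ρ : ℝ) {S : Set ℂ}
    (hS : MeasurableSet S) {f g : α → ℂ} (hf : Measurable f) (hg : Measurable g) :
    MeasurableSet {a | g a ∈ cyl ρ (f a) ∩ S} :=
  ((isOpen_setOf_mem_cyl ρ).measurableSet.preimage (hf.prodMk hg)).inter (hg hS)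

theorem measurable_turn {α : Type*} [MeasurableSpace α] (ρ : ℝ) {S : Set ℂ}
    (hS : MeasurableSet S) {f g : α → ℂ} (hf : Measurable f) (hg : Measurable g) :
    Measurable fun a => turn ρ S (f a) (g a) :=
  Measurable.ite (measurableSet_setOf_mem_cyl_inter ρ hS hf hg)
    (Complex.measurable_arg.comp (hg.div hf)) measurable_const

theorem measurable_next {α : Type*} [MeasurableSpace α] (ρ : ℝ) {S : Set ℂ}
    (hS : MeasurableSet S) {f g : α → ℂ} (hf : Measurable f) (hg : Measurable g) :
    Measurable fun a => next ρ S (f a) (g a) :=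
  Measurable.ite (measurableSet_setOf_mem_cyl_inter ρ hS hf hg) hg hf

theorem cosh_le_one_add_sq {x : ℝ} (hx : |x| ≤ 1) : Real.cosh x ≤ 1 + x ^ 2 := by
  have hx2 : x ^ 2 ≤ 1 := by rw [← sq_abs]; exact pow_le_one₀ (abs_nonneg _) hx
  have h1 := Real.cosh_le_exp_half_sq x
  have h2 := Real.abs_exp_sub_one_le (x := x ^ 2 / 2)
    (by rw [abs_of_nonneg (by positivity)]; linarith)
  rw [abs_of_nonneg (a := x ^ 2 / 2) (by positivity)] at h2
  have := le_abs_self (Real.exp (x ^ 2 / 2) - 1)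
  linarith

theorem turn_reflect {ρ s t : ℝ} (hs : 2 * ρ ≤ s) {z : ℂ} (hz : z ≠ 0) (y : ℂ) :
    turn ρ (shell s t) z (reflect z y) = -turn ρ (shell s t) z y := by
  by_cases h : y ∈ cyl ρ z ∩ shell s t
  · have h' : reflect z y ∈ cyl ρ z ∩ shell s t :=
      ⟨reflect_mem_cyl h.1, by rw [shell, Set.mem_ofPred_eq, norm_reflect hz]; exact h.2⟩
    rw [turn, turn, if_pos h, if_pos h', reflect_div hz, Complex.arg_conj, if_neg]
    intro e
    have := Complex.abs_arg_le_pi_div_two_iff.2 (re_div_pos_of_mem_cyl h.1 (hs.trans h.2.1)).le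
    rw [e, abs_of_pos Real.pi_pos] at this
    linarith [Real.pi_pos]
  · have h' : reflect z y ∉ cyl ρ z ∩ shell s t := by
      rintro ⟨h1, h2⟩
      rw [shell, Set.mem_ofPred_eq, norm_reflect hz] at h2
      exact h ⟨(reflect_mem_cyl_iff hz).1 h1, h2⟩
    rw [turn, turn, if_neg h, if_neg h', neg_zero]

/-- A law on the plane that is, away from `0`, a multiple of the area on a shell is invariant
under the reflections at lines through `0`. -/
theorem map_reflect_eq {μ : Measure ℂ} [IsProbabilityMeasure μ] {s t : ℝ} {c : ENNReal}
    (hμ : ∀ B : Set ℂ, MeasurableSet B → (0 : ℂ) ∉ B → μ B = c * volume (shell s t ∩ B))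
    {z : ℂ} (hz : z ≠ 0) : μ.map (reflect z) = μ := by
  have hm := (measurePreserving_reflect hz).measurable
  have key : ∀ B : Set ℂ, MeasurableSet B → (0 : ℂ) ∉ B → μ (reflect z ⁻¹' B) = μ B := by
    intro B hB h0
    rw [hμ B hB h0, hμ _ (hm hB) (by simpa [reflect] using h0),
      ← (measurePreserving_reflect hz).measure_preimage
        ((measurableSet_shell s t).inter hB).nullMeasurableSet, Set.preimage_inter]
    congr 3
    ext y
    simp [shell, norm_reflect hz]
  ext B hB
  rw [Measure.map_apply hm hB]
  by_cases h0 : (0 : ℂ) ∈ B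
  · have := key Bᶜ hB.compl (by simpa using h0)
    rw [Set.preimage_compl, prob_compl_eq_one_sub (hm hB), prob_compl_eq_one_sub hB] at this
    exact (ENNReal.sub_right_inj ENNReal.one_ne_top prob_le_one prob_le_one).1 this
  · exact key B hB h0

theorem abs_turn_le {ρ s t : ℝ} (hρ : 0 < ρ) (hs : 2 * ρ ≤ s) (z y : ℂ) :
    |turn ρ (shell s t) z y| ≤ Real.pi / 2 * (ρ / s) := by
  have hs0 : 0 < s := by linarith
  by_cases h : y ∈ cyl ρ z ∩ shell s t
  · rw [turn, if_pos h]
    refine (abs_arg_div_le_of_mem_cyl hρ h.1 (hs.trans h.2.1)).trans ?_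
    have := h.2.1
    gcongr
  · rw [turn, if_neg h, abs_zero]
    have := Real.pi_pos
    positivity

theorem exp_turn_add_exp_neg_turn_le {ρ s t l : ℝ} (hρ : 0 < ρ) (hs : 2 * ρ ≤ s)
    (hl : |l| * (Real.pi / 2 * (ρ / s)) ≤ 1) (z y : ℂ) :
    Real.exp (l * turn ρ (shell s t) z y) + Real.exp (-(l * turn ρ (shell s t) z y)) ≤
      2 * (1 + (l * (Real.pi / 2 * (ρ / s))) ^ 2) := by
  have h1 : |l * turn ρ (shell s t) z y| ≤ |l| * (Real.pi / 2 * (ρ / s)) := by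
    rw [abs_mul]
    have := abs_turn_le (t := t) hρ hs z y
    gcongr
  have h2 := cosh_le_one_add_sq (h1.trans hl)
  have h3 : (l * turn ρ (shell s t) z y) ^ 2 ≤ (l * (Real.pi / 2 * (ρ / s))) ^ 2 := by
    rw [← sq_abs, mul_pow l, ← sq_abs l, ← mul_pow]
    gcongr
  rw [Real.cosh_eq] at h2
  linarith

/-- The turn is symmetric by reflection, which turns its exponential moment into the mean of a
hyperbolic cosine; this differs from `1` only if there is a point in the cylinder, and then by at most
the square of `l` times the angle. -/
theorem lintegral_exp_turn_le {μ : Measure ℂ} [IsProbabilityMeasure μ] {ρ s t l : ℝ} {c : ENNReal}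
    (hρ : 0 < ρ) (hs : 2 * ρ ≤ s) (hst : s ≤ t) (hts : t ≤ 2 * s) (hc : c ≤ 1)
    (hμ : ∀ B : Set ℂ, MeasurableSet B → (0 : ℂ) ∉ B → μ B = c * volume (shell s t ∩ B))
    (hl : |l| * (Real.pi / 2 * (ρ / s)) ≤ 1) (z : ℂ) :
    ∫⁻ y, ENNReal.ofReal (Real.exp (l * turn ρ (shell s t) z y)) ∂μ ≤
      ENNReal.ofReal
        (1 + (l * (Real.pi / 2 * (ρ / s))) ^ 2 * (2 * Real.pi * ρ * (t - s))) := by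
  have hs0 : 0 < s := by linarith
  have hR : 0 ≤ 2 * Real.pi * ρ * (t - s) :=
    mul_nonneg (mul_pos (mul_pos two_pos Real.pi_pos) hρ).le (by linarith)
  have hturn : Measurable fun y => turn ρ (shell s t) z y :=
    measurable_turn ρ (measurableSet_shell s t) measurable_const measurable_id
  have hf : Measurable fun y => ENNReal.ofReal (Real.exp (l * turn ρ (shell s t) z y)) := by
    fun_prop
  have hexp := fun y => exp_turn_add_exp_neg_turn_le (t := t) hρ hs hl z y
  have ha : 0 ≤ (l * (Real.pi / 2 * (ρ / s))) ^ 2 := sq_nonneg _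
  generalize (l * (Real.pi / 2 * (ρ / s))) ^ 2 = a at hexp ha ⊢
  by_cases hz : z = 0
  · have : ∀ y, turn ρ (shell s t) z y = 0 := fun y => by
      rw [turn, if_neg]
      exact fun h => ne_zero_of_mem_cyl h.1 hz
    simp only [this, mul_zero, Real.exp_zero, ENNReal.ofReal_one, lintegral_one, measure_univ]
    rw [← ENNReal.ofReal_one]
    exact ENNReal.ofReal_le_ofReal (by linarith [mul_nonneg ha hR])
  obtain ⟨D, hD⟩ : ∃ D, D = cyl ρ z ∩ shell s t := ⟨_, rfl⟩
  have hDm : MeasurableSet D := by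
    rw [hD]
    exact measurableSet_setOf_mem_cyl_inter ρ (measurableSet_shell s t) measurable_const
      measurable_id
  have hD0 : (0 : ℂ) ∉ D := by
    rw [hD]
    rintro ⟨-, h, -⟩
    rw [norm_zero] at h
    linarith
  have hμD : μ D ≤ ENNReal.ofReal (2 * Real.pi * ρ * (t - s)) := by
    rw [hμ D hDm hD0]
    calc c * volume (shell s t ∩ D) ≤ 1 * volume (cyl ρ z ∩ shell s t) := by
          refine mul_le_mul' hc (measure_mono ?_)
          rw [hD]
          exact Set.inter_subset_right
      _ ≤ _ := by rw [one_mul]; exact volume_cyl_inter_shell_le hρ hs hts z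
  have hpt : ∀ y, ENNReal.ofReal (Real.exp (l * turn ρ (shell s t) z y)) +
      ENNReal.ofReal (Real.exp (l * turn ρ (shell s t) z (reflect z y))) ≤
      2 * (1 + D.indicator (fun _ => ENNReal.ofReal a) y) := by
    intro y
    rw [turn_reflect hs hz, mul_neg, ← ENNReal.ofReal_add (Real.exp_pos _).le (Real.exp_pos _).le]
    by_cases h : y ∈ D
    · rw [Set.indicator_of_mem h, ← ENNReal.ofReal_one, ← ENNReal.ofReal_add zero_le_one ha,
        ← ENNReal.ofReal_ofNat, ← ENNReal.ofReal_mul zero_le_two]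
      exact ENNReal.ofReal_le_ofReal (hexp y)
    · rw [hD] at h
      rw [hD, Set.indicator_of_notMem h, turn, if_neg h]
      norm_num
  have h2 : 2 * ∫⁻ y, ENNReal.ofReal (Real.exp (l * turn ρ (shell s t) z y)) ∂μ ≤
      2 * (1 + ENNReal.ofReal a * μ D) := by
    calc _ = ∫⁻ y, (ENNReal.ofReal (Real.exp (l * turn ρ (shell s t) z y)) +
          ENNReal.ofReal (Real.exp (l * turn ρ (shell s t) z (reflect z y)))) ∂μ := by
          rw [lintegral_add_left hf, two_mul]
          congr 1
          nth_rewrite 1 [← map_reflect_eq hμ hz]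
          rw [lintegral_map hf (measurePreserving_reflect hz).measurable]
      _ ≤ ∫⁻ y, 2 * (1 + D.indicator (fun _ => ENNReal.ofReal a) y) ∂μ := lintegral_mono hpt
      _ = _ := by
          rw [lintegral_const_mul' _ _ ENNReal.ofNat_ne_top,
            lintegral_add_left measurable_const,
            lintegral_indicator_const hDm]
          simp
  have h3 := (ENNReal.mul_le_mul_iff_right two_ne_zero ENNReal.ofNat_ne_top).1 h2
  refine h3.trans ?_
  rw [ENNReal.ofReal_add zero_le_one (mul_nonneg ha hR), ENNReal.ofReal_one,
    ENNReal.ofReal_mul ha]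
  gcongr

end Step

end RadialPoissonTree

/-! ### Exponential moments of the angle of the walk -/

namespace RadialPoissonTree

section Walk

/-- The walk that starts at `s 0` on the real axis, passes the shells between the radii
`s 0 ≥ s 1 ≥ …` from the outside to the inside, and meets at most the point `y j` in the shell
between `s (j + 1)` and `s j`. The second component is its angle, added up from the turns. -/
noncomputable def walk (ρ : ℝ) (s : ℕ → ℝ) (y : ℕ → ℂ) : ℕ → ℂ × ℝ
  | 0 => (s 0, 0)
  | j + 1 => (next ρ (shell (s (j + 1)) (s j)) (walk ρ s y j).1 (y j),
      (walk ρ s y j).2 + turn ρ (shell (s (j + 1)) (s j)) (walk ρ s y j).1 (y j))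

theorem measurable_walk (ρ : ℝ) (s : ℕ → ℝ) (j : ℕ) : Measurable fun y => walk ρ s y j := by
  induction j with
  | zero => exact measurable_const
  | succ j ih =>
    have h1 : Measurable fun y => (walk ρ s y j).1 := measurable_fst.comp ih
    have h2 : Measurable fun y : ℕ → ℂ => y j := measurable_pi_apply j
    exact (measurable_next ρ (measurableSet_shell _ _) h1 h2).prodMk
      ((measurable_snd.comp ih).add (measurable_turn ρ (measurableSet_shell _ _) h1 h2))

theorem walk_congr (ρ : ℝ) (s : ℕ → ℝ) {y y' : ℕ → ℂ} {j : ℕ} (h : ∀ i < j, y i = y' i) :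
    walk ρ s y j = walk ρ s y' j := by
  induction j with
  | zero => rfl
  | succ j ih =>
    rw [walk, walk, ih fun i hi => h i (hi.trans j.lt_succ_self), h j j.lt_succ_self]

theorem pairwise_disjoint_shell {s : ℕ → ℝ} (hs : Antitone s) :
    Pairwise (Function.onFun Disjoint fun j => shell (s (j + 1)) (s j)) := by
  have key : ∀ i j, i < j → Disjoint (shell (s (i + 1)) (s i)) (shell (s (j + 1)) (s j)) := by
    intro i j hij
    rw [Set.disjoint_left]
    rintro z ⟨h1, -⟩ ⟨-, h2⟩
    exact absurd (hs (Nat.succ_le_of_lt hij)) (not_le.2 (h1.trans_lt h2))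
  intro i j hij
  rcases lt_or_gt_of_ne hij with h | h
  · exact key i j h
  · exact (key j i h).symm

variable {Ω : Type*} [MeasurableSpace Ω] {P : Measure Ω}

theorem indepFun_walk (ρ : ℝ) (s : ℕ → ℝ) {Y : ℕ → Ω → ℂ} (hY : ∀ i, Measurable (Y i))
    (hind : iIndepFun Y P) (j : ℕ) :
    IndepFun (fun ω => (walk ρ s (fun i => Y i ω) j)) (Y j) P := by
  have h := hind.indepFun_finset (Finset.range j) {j} (by simp) hY
  -- The walk up to time `j` is a function of the first `j` points, extended by `0`.
  let ext : (Finset.range j → ℂ) → ℕ → ℂ := fun v i =>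
    if hi : i ∈ Finset.range j then v ⟨i, hi⟩ else 0
  have hext : Measurable ext := by
    rw [measurable_pi_iff]
    intro i
    by_cases hi : i ∈ Finset.range j
    · simp only [ext, hi, dite_true]
      exact measurable_pi_apply _
    · simp only [ext, hi, dite_false]
      exact measurable_const
  have h2 := h.comp ((measurable_walk ρ s j).comp hext)
    (measurable_pi_apply (⟨j, by simp⟩ : ({j} : Finset ℕ)))
  refine (show (((fun y => walk ρ s y j) ∘ ext) ∘ fun ω i => Y i ω) =
    fun ω => walk ρ s (fun i => Y i ω) j from ?_) ▸ h2
  funext ω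
  apply walk_congr
  intro i hi
  simp [ext, hi]

theorem exp_step_le {ρ l a b : ℝ} (hρ : 0 < ρ) (ha : 0 < a) (hab : a ≤ b) (hba : b ≤ 2 * a) :
    1 + (l * (Real.pi / 2 * (ρ / a))) ^ 2 * (2 * Real.pi * ρ * (b - a)) ≤
      Real.exp (Real.pi ^ 3 * ρ ^ 3 * l ^ 2 * (1 / a - 1 / b)) := by
  rw [add_comm]
  refine le_trans ?_ (Real.add_one_le_exp _)
  have hb : 0 < b := by linarith
  have e1 : (l * (Real.pi / 2 * (ρ / a))) ^ 2 * (2 * Real.pi * ρ * (b - a)) =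
      Real.pi ^ 3 * ρ ^ 3 * l ^ 2 * ((b - a) / (2 * a * a)) := by
    field_simp
  have e2 : 1 / a - 1 / b = (b - a) / (b * a) := by
    field_simp
  rw [e1, e2]
  have hba0 : 0 ≤ b - a := by linarith
  have := Real.pi_pos
  gcongr

/-- The factors contributed by the shells telescope, because the turn in the shell between `a` and
`b` is of order `1 / a` and has probability of order `b - a`. -/
theorem lintegral_exp_walk_le [IsProbabilityMeasure P] {N : Ω → Set ℂ}
    (hN : IsUnitPoissonProcess P N) {ρ : ℝ} (hρ : 0 < ρ) {s : ℕ → ℝ} (hs : Antitone s) {J : ℕ}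
    (hJ : 2 * ρ ≤ s J) (hstep : ∀ j < J, s j ≤ 2 * s (j + 1)) {l : ℝ}
    (hl : |l| * (Real.pi / 2 * (ρ / s J)) ≤ 1) {j : ℕ} (hj : j ≤ J) :
    ∫⁻ ω, ENNReal.ofReal (Real.exp (l * (walk ρ s
        (fun i => solePoint (N ω ∩ shell (s (i + 1)) (s i))) j).2)) ∂P ≤
      ENNReal.ofReal (Real.exp (Real.pi ^ 3 * ρ ^ 3 * l ^ 2 * (1 / s j - 1 / s 0))) := by
  obtain ⟨Y, hYdef⟩ : ∃ Y : ℕ → Ω → ℂ,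
      Y = fun i ω => solePoint (N ω ∩ shell (s (i + 1)) (s i)) := ⟨_, rfl⟩
  have hY : ∀ i, Measurable (Y i) := fun i => by
    rw [hYdef]
    exact hN.measurable_solePoint (measurableSet_shell _ _)
  have hind : iIndepFun Y P := by
    rw [hYdef]
    exact hN.iIndepFun_solePoint (fun i => measurableSet_shell _ _) (pairwise_disjoint_shell hs)
  have e : ∀ ω, (fun i => solePoint (N ω ∩ shell (s (i + 1)) (s i))) = fun i => Y i ω := by
    rw [hYdef]
    exact fun ω => rfl
  simp only [e]
  have hW : ∀ j, Measurable fun ω => walk ρ s (fun i => Y i ω) j := fun j =>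
    (measurable_walk ρ s j).comp (measurable_pi_iff.2 hY)
  induction j with
  | zero => simp [walk]
  | succ j ih =>
    have hjJ : j < J := hj
    have hsJ : s J ≤ s (j + 1) := hs hj
    have hpos : 0 < s (j + 1) := by linarith
    have hsj : s (j + 1) ≤ s j := hs j.le_succ
    have hl' : |l| * (Real.pi / 2 * (ρ / s (j + 1))) ≤ 1 := by
      refine le_trans ?_ hl
      have : 0 < s J := by linarith
      have := Real.pi_pos
      gcongr
    have hv : volume (shell (s (j + 1)) (s j)) ≠ ⊤ := by
      rw [volume_shell hpos.le hsj]
      exact ENNReal.ofReal_ne_top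
    have hpr : IsProbabilityMeasure (P.map (Y j)) :=
      Measure.isProbabilityMeasure_map (hY j).aemeasurable
    have hone : ∀ z, ∫⁻ y, ENNReal.ofReal
        (Real.exp (l * turn ρ (shell (s (j + 1)) (s j)) z y)) ∂(P.map (Y j)) ≤
        ENNReal.ofReal (Real.exp (Real.pi ^ 3 * ρ ^ 3 * l ^ 2 * (1 / s (j + 1) - 1 / s j))) := by
      intro z
      refine (lintegral_exp_turn_le (c := ENNReal.ofReal
        (Real.exp (-(volume (shell (s (j + 1)) (s j))).toReal))) hρ (hJ.trans hsJ) hsj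
        (hstep j hjJ) ?_ ?_ hl' z).trans (ENNReal.ofReal_le_ofReal
          (exp_step_le hρ hpos hsj (hstep j hjJ)))
      · rw [ENNReal.ofReal_le_one, Real.exp_le_one_iff, neg_nonpos]
        exact ENNReal.toReal_nonneg
      · intro B hB h0
        rw [hYdef]
        exact hN.map_solePoint_apply (measurableSet_shell _ _) hv hB h0
    have hprod := (indepFun_walk ρ s hY hind j).map_prod_eq_prod_map_map (hW j).aemeasurable
      (hY j).aemeasurable
    have hturn : Measurable fun p : (ℂ × ℝ) × ℂ => turn ρ (shell (s (j + 1)) (s j)) p.1.1 p.2 :=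
      measurable_turn ρ (measurableSet_shell _ _) (measurable_fst.comp measurable_fst)
        measurable_snd
    have hF : Measurable fun p : (ℂ × ℝ) × ℂ => ENNReal.ofReal (Real.exp (l * p.1.2)) *
        ENNReal.ofReal (Real.exp (l * turn ρ (shell (s (j + 1)) (s j)) p.1.1 p.2)) := by
      fun_prop
    have hG : Measurable fun p : ℂ × ℝ => ENNReal.ofReal (Real.exp (l * p.2)) := by fun_prop
    calc _ = ∫⁻ ω, (fun p : (ℂ × ℝ) × ℂ => ENNReal.ofReal (Real.exp (l * p.1.2)) *
          ENNReal.ofReal (Real.exp (l * turn ρ (shell (s (j + 1)) (s j)) p.1.1 p.2)))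
            (walk ρ s (fun i => Y i ω) j, Y j ω) ∂P := by
          refine lintegral_congr fun ω => ?_
          simp only [walk]
          rw [← ENNReal.ofReal_mul (Real.exp_pos _).le, ← Real.exp_add, ← mul_add]
      _ = ∫⁻ p, ENNReal.ofReal (Real.exp (l * p.1.2)) *
          ENNReal.ofReal (Real.exp (l * turn ρ (shell (s (j + 1)) (s j)) p.1.1 p.2))
            ∂((P.map fun ω => walk ρ s (fun i => Y i ω) j).prod (P.map (Y j))) := by
          rw [← hprod, lintegral_map hF ((hW j).prodMk (hY j))]
      _ = ∫⁻ w, ∫⁻ y, ENNReal.ofReal (Real.exp (l * w.2)) *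
          ENNReal.ofReal (Real.exp (l * turn ρ (shell (s (j + 1)) (s j)) w.1 y))
            ∂(P.map (Y j)) ∂(P.map fun ω => walk ρ s (fun i => Y i ω) j) :=
          lintegral_prod _ hF.aemeasurable
      _ ≤ ∫⁻ w, ENNReal.ofReal (Real.exp (l * w.2)) * ENNReal.ofReal
          (Real.exp (Real.pi ^ 3 * ρ ^ 3 * l ^ 2 * (1 / s (j + 1) - 1 / s j)))
            ∂(P.map fun ω => walk ρ s (fun i => Y i ω) j) := by
          refine lintegral_mono fun w => ?_
          rw [lintegral_const_mul' _ _ ENNReal.ofReal_ne_top]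
          exact mul_le_mul_right (hone w.1) _
      _ = (∫⁻ ω, ENNReal.ofReal (Real.exp (l * (walk ρ s (fun i => Y i ω) j).2)) ∂P) *
          ENNReal.ofReal
            (Real.exp (Real.pi ^ 3 * ρ ^ 3 * l ^ 2 * (1 / s (j + 1) - 1 / s j))) := by
          rw [lintegral_mul_const _ hG, lintegral_map hG (hW j)]
      _ ≤ _ := mul_le_mul_left (ih hjJ.le) _
      _ = _ := by
          rw [← ENNReal.ofReal_mul (Real.exp_pos _).le, ← Real.exp_add]
          congr 2
          ring

/-- Chernoff's bound for the angle of the walk. The exponent `l` is free: its best choice depends on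
`s j`. -/
theorem measure_le_abs_walk_le [IsProbabilityMeasure P] {N : Ω → Set ℂ}
    (hN : IsUnitPoissonProcess P N) {ρ : ℝ} (hρ : 0 < ρ) {s : ℕ → ℝ} (hs : Antitone s) {j : ℕ}
    (hj : 2 * ρ ≤ s j) (hstep : ∀ i < j, s i ≤ 2 * s (i + 1)) {l : ℝ} (hl0 : 0 ≤ l)
    (hl : l * (Real.pi / 2 * (ρ / s j)) ≤ 1) (a : ℝ) :
    P {ω | a ≤ |(walk ρ s (fun i => solePoint (N ω ∩ shell (s (i + 1)) (s i))) j).2|} ≤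
      2 * ENNReal.ofReal (Real.exp (Real.pi ^ 3 * ρ ^ 3 * l ^ 2 / s j - l * a)) := by
  have hsj : 0 < s j := by linarith
  have hs0 : 0 < s 0 := hsj.trans_le (hs (Nat.zero_le j))
  have hmeas : Measurable fun ω =>
      (walk ρ s (fun i => solePoint (N ω ∩ shell (s (i + 1)) (s i))) j).2 :=
    measurable_snd.comp ((measurable_walk ρ s j).comp
      (measurable_pi_iff.2 fun i => hN.measurable_solePoint (measurableSet_shell _ _)))
  have key : ∀ m : ℝ, |m| = l →
      P {ω | l * a ≤ m * (walk ρ s (fun i => solePoint (N ω ∩ shell (s (i + 1)) (s i))) j).2} ≤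
        ENNReal.ofReal (Real.exp (Real.pi ^ 3 * ρ ^ 3 * l ^ 2 / s j - l * a)) := by
    intro m hm
    have h := lintegral_exp_walk_le (l := m) hN hρ hs hj hstep (by rwa [hm]) le_rfl
    have hmar := mul_meas_ge_le_lintegral (μ := P) (f := fun ω => ENNReal.ofReal (Real.exp
      (m * (walk ρ s (fun i => solePoint (N ω ∩ shell (s (i + 1)) (s i))) j).2)))
      (by fun_prop) (ENNReal.ofReal (Real.exp (l * a)))
    have hsub : {ω | l * a ≤
        m * (walk ρ s (fun i => solePoint (N ω ∩ shell (s (i + 1)) (s i))) j).2} ⊆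
        {ω | ENNReal.ofReal (Real.exp (l * a)) ≤ ENNReal.ofReal (Real.exp
          (m * (walk ρ s (fun i => solePoint (N ω ∩ shell (s (i + 1)) (s i))) j).2))} :=
      fun ω hω => ENNReal.ofReal_le_ofReal (Real.exp_le_exp.2 hω)
    refine (measure_mono hsub).trans ?_
    rw [Real.exp_sub, ENNReal.ofReal_div_of_pos (Real.exp_pos _),
      ENNReal.le_div_iff_mul_le (Or.inl (by simp [Real.exp_pos])) (Or.inl ENNReal.ofReal_ne_top),
      mul_comm]
    refine hmar.trans (h.trans (ENNReal.ofReal_le_ofReal (Real.exp_le_exp.2 ?_)))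
    rw [← sq_abs m, hm]
    have h1 : 0 ≤ 1 / s 0 := by positivity
    have h2 : 1 / s j - 1 / s 0 ≤ 1 / s j := by linarith
    have h3 : 0 ≤ Real.pi ^ 3 * ρ ^ 3 * l ^ 2 := by
      have := Real.pi_pos
      positivity
    simpa only [mul_one_div] using mul_le_mul_of_nonneg_left h2 h3
  calc _ ≤ P ({ω | l * a ≤ l * (walk ρ s
          (fun i => solePoint (N ω ∩ shell (s (i + 1)) (s i))) j).2} ∪
        {ω | l * a ≤ -l * (walk ρ s
          (fun i => solePoint (N ω ∩ shell (s (i + 1)) (s i))) j).2}) := by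
        refine measure_mono fun ω hω => ?_
        rcases le_abs'.1 (show a ≤ |_| from hω) with h | h
        · right
          change l * a ≤ -l * _
          rw [neg_mul, ← mul_neg]
          exact mul_le_mul_of_nonneg_left (by linarith) hl0
        · left
          exact mul_le_mul_of_nonneg_left h hl0
    _ ≤ _ := measure_union_le _ _
    _ ≤ _ := by
        rw [two_mul]
        exact add_le_add (key l (abs_of_nonneg hl0)) (key (-l) (by rw [abs_neg, abs_of_nonneg hl0]))

end Walk

end RadialPoissonTree

/-! ### The branch follows the walk -/

namespace RadialPoissonTree

section Branch

theorem ancestor_eq_zero_or (ρ : ℝ) (V : Set ℂ) (X : ℂ) :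
    ancestor ρ V X = 0 ∨ (ancestor ρ V X ∈ cyl ρ X ∩ V ∧
      ∀ Z ∈ cyl ρ X ∩ V, ‖Z‖ ≤ ‖ancestor ρ V X‖) := by
  unfold ancestor
  split_ifs with h
  · exact Or.inr h.choose_spec
  · exact Or.inl rfl

theorem solePoint_eq_zero_or_mem (A : Set ℂ) : solePoint A = 0 ∨ solePoint A ∈ A := by
  by_cases h : A.encard = 1
  · obtain ⟨y, rfl⟩ := Set.encard_eq_one.1 h
    right
    rw [solePoint_singleton]
    rfl
  · exact Or.inl (solePoint_of_encard_ne_one h)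

theorem exists_mem_shell {s : ℕ → ℝ} {i k : ℕ} {x : ℂ} (hs : Antitone s) (hi : ‖x‖ < s i)
    (hk : s k ≤ ‖x‖) : ∃ j, i ≤ j ∧ j < k ∧ x ∈ shell (s (j + 1)) (s j) := by
  classical
  have hex : ∃ m, s m ≤ ‖x‖ := ⟨k, hk⟩
  have him : i < Nat.find hex := by
    by_contra h
    exact absurd (hs (not_lt.1 h)) (not_le.2 ((Nat.find_spec hex).trans_lt hi))
  obtain ⟨j, hj⟩ := Nat.exists_eq_succ_of_ne_zero (Nat.ne_zero_of_lt him)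
  refine ⟨j, by omega, ?_, ?_, ?_⟩
  · have := Nat.find_min' hex hk
    omega
  · have := Nat.find_spec hex
    rwa [hj] at this
  · exact not_le.1 (Nat.find_min hex (by omega))

variable {ρ : ℝ} {s : ℕ → ℝ} {J : ℕ} {A : Set ℂ}

/-- If there is at most one point in each shell, then the walk meets all vertices of the branch of
norm at least `s J`, each of them when it leaves the shell of that vertex. -/
theorem branch_eq_walk (hs : Antitone s) (hpos : 0 < s J)
    (hJ : ρ ≤ s J) (hA : ∀ j < J, (A ∩ shell (s (j + 1)) (s j)).encard ≤ 1) (k : ℕ) :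
    ‖branch ρ A (s 0) k‖ < s J ∨ ∃ j ≤ J,
      branch ρ A (s 0) k =
        (walk ρ s (fun i => solePoint (A ∩ shell (s (i + 1)) (s i))) j).1 ∧
      (j = 0 ∨ ∃ i, j = i + 1 ∧ branch ρ A (s 0) k ∈ A ∩ shell (s (i + 1)) (s i)) := by
  induction k with
  | zero => exact Or.inr ⟨0, Nat.zero_le _, rfl, Or.inl rfl⟩
  | succ k ih =>
    have hsucc : branch ρ A (s 0) (k + 1) =
        ancestor ρ (A \ Metric.ball 0 ρ) (branch ρ A (s 0) k) :=
      Function.iterate_succ_apply' _ _ _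
    rw [hsucc]
    obtain ⟨X, hX⟩ : ∃ X, X = branch ρ A (s 0) k := ⟨_, rfl⟩
    rw [← hX] at ih ⊢
    rcases ancestor_eq_zero_or ρ (A \ Metric.ball 0 ρ) X with h0 | ⟨hmem, hmax⟩
    · left
      rwa [h0, norm_zero]
    generalize ancestor ρ (A \ Metric.ball 0 ρ) X = W at hmem hmax ⊢
    have hWX := norm_lt_of_mem_cyl hmem.1
    rcases ih with h | ⟨j, hj, hXj, hjX⟩
    · exact Or.inl (hWX.trans h)
    by_cases hWJ : ‖W‖ < s J
    · exact Or.inl hWJ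
    right
    -- The shell of `X` contains no other point, so that `W` lies inside of it.
    have hWj : ‖W‖ < s j := by
      rcases hjX with rfl | ⟨i, rfl, hXi⟩
      · rw [hXj] at hWX
        simpa [walk, abs_of_pos (hpos.trans_le (hs (Nat.zero_le J)))] using hWX
      · by_contra hle
        have hWi : W ∈ A ∩ shell (s (i + 1)) (s i) :=
          ⟨hmem.2.1, not_lt.1 hle, hWX.trans hXi.2.2⟩
        have := Set.encard_le_one_iff.1 (hA i hj) W X hWi hXi
        rw [this] at hWX
        exact lt_irrefl _ hWX
    obtain ⟨i, hji, hiJ, hWi⟩ := exists_mem_shell hs hWj (not_lt.1 hWJ)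
    -- A point met before would be a vertex in the cylinder of larger norm than `W`.
    have hstay : ∀ m, j ≤ m → m ≤ i →
        (walk ρ s (fun i => solePoint (A ∩ shell (s (i + 1)) (s i))) m).1 = X := by
      intro m hm
      induction m, hm using Nat.le_induction with
      | base => exact fun _ => hXj.symm
      | succ m hm ihm =>
        intro hmi
        rw [walk, ihm (by omega)]
        change next ρ _ X _ = X
        rw [next, if_neg]
        rintro ⟨hc, hsh⟩
        have hsm : s J ≤ s (m + 1) := hs (by omega)
        have hnorm := hsm.trans hsh.1
        rcases solePoint_eq_zero_or_mem (A ∩ shell (s (m + 1)) (s m)) with h | h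
        · rw [h, norm_zero] at hnorm
          linarith
        · have h1 := hmax _ ⟨hc, h.1, by simpa using hJ.trans hnorm⟩
          have h2 : s i ≤ s (m + 1) := hs hmi
          have h3 := hsh.1
          have h4 := hWi.2
          linarith
    have hsole : A ∩ shell (s (i + 1)) (s i) = {W} :=
      Set.eq_singleton_iff_unique_mem.2 ⟨⟨hmem.2.1, hWi⟩, fun y hy =>
        Set.encard_le_one_iff.1 (hA i hiJ) y W hy ⟨hmem.2.1, hWi⟩⟩
    refine ⟨i + 1, hiJ, ?_, Or.inr ⟨i, rfl, hmem.2.1, hWi⟩⟩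
    rw [walk, hstay i hji le_rfl, hsole, solePoint_singleton]
    change W = next ρ _ X W
    rw [next, if_pos ⟨hmem.1, hWi⟩]

theorem walk_fst_eq_norm_mul_exp (hs0 : 0 ≤ s 0) (y : ℕ → ℂ) (j : ℕ) :
    (walk ρ s y j).1 = ‖(walk ρ s y j).1‖ * Complex.exp ((walk ρ s y j).2 * Complex.I) := by
  induction j with
  | zero => simp [walk, abs_of_nonneg hs0]
  | succ j ih =>
    rw [walk]
    generalize walk ρ s y j = w at ih ⊢
    simp only [next, turn]
    split_ifs with h
    · have hz := ne_zero_of_mem_cyl h.1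
      have hz' : (‖w.1‖ : ℂ) ≠ 0 := by simpa using hz
      calc y j = w.1 * (y j / w.1) := by field_simp
        _ = (‖w.1‖ * Complex.exp (w.2 * Complex.I)) *
            (‖y j / w.1‖ * Complex.exp ((y j / w.1).arg * Complex.I)) := by
          rw [← ih, Complex.norm_mul_exp_arg_mul_I]
        _ = _ := by
          rw [norm_div, Complex.ofReal_add, add_mul, Complex.exp_add]
          push_cast
          field_simp
    · simpa using ih

theorem abs_im_walk_le (hs0 : 0 ≤ s 0) (y : ℕ → ℂ) (j : ℕ) :
    |(walk ρ s y j).1.im| ≤ ‖(walk ρ s y j).1‖ * |(walk ρ s y j).2| := by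
  rw [walk_fst_eq_norm_mul_exp hs0, Complex.im_ofReal_mul, Complex.exp_ofReal_mul_I_im, abs_mul,
    ← walk_fst_eq_norm_mul_exp hs0, abs_norm]
  exact mul_le_mul_of_nonneg_left Real.abs_sin_le_abs (norm_nonneg _)

/-- If there is at most one point in each shell, then a deviation of the branch by `a` forces the walk
to have an angle of order `a / s j` at a level `s j`: a vertex in the shell inside the radius `s i`
has norm at most `s i ≤ 2 * s (i + 1)`, and the vertices of norm less than `s J ≤ a / 2` do not
matter. -/
theorem exists_le_abs_walk_of_le_maxDeviation (hs : Antitone s) (hpos : 0 < s J)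
    (hJ : ρ ≤ s J) (hA : ∀ j < J, (A ∩ shell (s (j + 1)) (s j)).encard ≤ 1)
    (hstep : ∀ j < J, s j ≤ 2 * s (j + 1)) {a : ℝ} (ha : 2 * s J ≤ a)
    (hdev : a ≤ maxDeviation ρ A (s 0)) :
    ∃ j ≤ J, a / (4 * s j) ≤
      |(walk ρ s (fun i => solePoint (A ∩ shell (s (i + 1)) (s i))) j).2| := by
  by_contra! hcon
  have hs0 : 0 < s 0 := hpos.trans_le (hs (Nat.zero_le J))
  have : maxDeviation ρ A (s 0) ≤ a / 2 := by
    refine ciSup_le fun k => ?_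
    rcases branch_eq_walk hs hpos hJ hA k with h | ⟨j, hj, hX, h⟩
    · have := Complex.abs_im_le_norm (branch ρ A (s 0) k)
      linarith
    · have hsj : 0 < s j := hpos.trans_le (hs hj)
      have hnorm : ‖branch ρ A (s 0) k‖ ≤ 2 * s j := by
        rcases h with rfl | ⟨i, rfl, hi⟩
        · rw [hX]
          simp only [walk, Complex.norm_real, Real.norm_eq_abs, abs_of_pos hs0]
          linarith
        · exact hi.2.2.le.trans (hstep i hj)
      have h1 := abs_im_walk_le (ρ := ρ) hs0.le
        (fun i => solePoint (A ∩ shell (s (i + 1)) (s i))) j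
      rw [← hX] at h1
      calc _ ≤ _ := h1
        _ ≤ 2 * s j * (a / (4 * s j)) := by
          gcongr
          exact (hcon j hj).le
        _ = _ := by
          field_simp
          ring
  linarith

end Branch

end RadialPoissonTree

/-! ### The union bound over the shells -/

namespace RadialPoissonTree

section Deviation

variable {Ω : Type*} [MeasurableSpace Ω] {P : Measure Ω} [IsProbabilityMeasure P] {N : Ω → Set ℂ}

/-- For the Chernoff bound at the level `s j` the exponent is scaled with `√(s j)`, the order of the
inverse of the standard deviation of the angle there. -/
theorem measure_le_maxDeviation_le (hN : IsUnitPoissonProcess P N) {ρ : ℝ} (hρ : 0 < ρ)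
    {s : ℕ → ℝ} (hs : Antitone s) {J : ℕ} (hJ : 2 * ρ ≤ s J)
    (hJ' : Real.pi / 2 * ρ ≤ √(s J)) (hstep : ∀ j < J, s j ≤ 2 * s (j + 1)) {a : ℝ}
    (ha : 2 * s J ≤ a) :
    P {ω | a ≤ maxDeviation ρ (N ω) (s 0)} ≤
      ∑ j ∈ Finset.range J, ENNReal.ofReal ((Real.pi * (s j ^ 2 - s (j + 1) ^ 2)) ^ 2) +
      ∑ _j ∈ Finset.range (J + 1), 2 * ENNReal.ofReal
        (Real.exp (Real.pi ^ 3 * ρ ^ 3 - a / (4 * √(s 0)))) := by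
  have hpos : 0 < s J := by linarith
  have hsub : {ω | a ≤ maxDeviation ρ (N ω) (s 0)} ⊆
      (⋃ j ∈ Finset.range J, {ω | 1 < (N ω ∩ shell (s (j + 1)) (s j)).encard}) ∪
      ⋃ j ∈ Finset.range (J + 1), {ω | a / (4 * s j) ≤
        |(walk ρ s (fun i => solePoint (N ω ∩ shell (s (i + 1)) (s i))) j).2|} := by
    intro ω hω
    by_cases h : ∃ j < J, 1 < (N ω ∩ shell (s (j + 1)) (s j)).encard
    · obtain ⟨j, hj, h⟩ := h
      exact Or.inl (Set.mem_biUnion (Finset.mem_coe.2 (Finset.mem_range.2 hj)) h)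
    · push Not at h
      obtain ⟨j, hj, h⟩ := exists_le_abs_walk_of_le_maxDeviation hs hpos (by linarith) h hstep ha hω
      exact Or.inr (Set.mem_biUnion (Finset.mem_coe.2 (Finset.mem_range.2 (by omega))) h)
  refine (measure_mono hsub).trans ((measure_union_le _ _).trans (add_le_add ?_ ?_))
  · refine (measure_biUnion_finset_le _ _).trans (Finset.sum_le_sum fun j hj => ?_)
    have hj' : j + 1 ≤ J := Finset.mem_range.1 hj
    have hs1 : 0 ≤ s (j + 1) := (hpos.trans_le (hs hj')).le
    have hs2 : s (j + 1) ≤ s j := hs j.le_succ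
    have hv := volume_shell hs1 hs2
    refine (hN.measure_one_lt_count_le (measurableSet_shell _ _)
      (by rw [hv]; exact ENNReal.ofReal_ne_top)).trans (le_of_eq ?_)
    rw [hv, ENNReal.toReal_ofReal]
    have : s (j + 1) ^ 2 ≤ s j ^ 2 := by gcongr
    exact mul_nonneg Real.pi_pos.le (by linarith)
  · refine (measure_biUnion_finset_le _ _).trans (Finset.sum_le_sum fun j hj => ?_)
    have hj' : j ≤ J := Nat.lt_succ_iff.1 (Finset.mem_range.1 hj)
    have hsJ : s J ≤ s j := hs hj'
    have hsj : 0 < s j := hpos.trans_le hsJ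
    have hq : 0 < √(s j) := Real.sqrt_pos.2 hsj
    have hsq : √(s j) ^ 2 = s j := Real.sq_sqrt hsj.le
    have h := measure_le_abs_walk_le (l := √(s j)) hN hρ hs (hJ.trans hsJ)
      (fun i hi => hstep i (hi.trans_le hj')) hq.le ?_ (a / (4 * s j))
    · refine h.trans ?_
      gcongr
      · rw [hsq, mul_div_assoc, div_self hsj.ne', mul_one]
      · rw [show √(s j) * (a / (4 * s j)) = a / (4 * √(s j)) by
          nth_rewrite 2 [← hsq]
          field_simp]
        have : √(s j) ≤ √(s 0) := Real.sqrt_le_sqrt (hs (Nat.zero_le j))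
        have : 0 ≤ a := by linarith
        gcongr
    · rw [show √(s j) * (Real.pi / 2 * (ρ / s j)) = Real.pi / 2 * ρ / √(s j) by
        nth_rewrite 2 [← hsq]
        field_simp]
      rw [div_le_one hq]
      exact hJ'.trans (Real.sqrt_le_sqrt hsJ)

/-- The bound for `J` shells of equal width between the radii `√r` and `r`. -/
theorem measure_le_maxDeviation_le_of_one_le (hN : IsUnitPoissonProcess P N) {ρ : ℝ} (hρ : 0 < ρ)
    {r : ℝ} (hr : 1 ≤ r) (hr1 : 2 * ρ ≤ √r) (hr2 : Real.pi / 2 * ρ ≤ √√r) {a : ℝ} (ha : 2 * √r ≤ a)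
    {J : ℕ} (hJ : r ≤ J) :
    P.real {ω | a ≤ maxDeviation ρ (N ω) r} ≤
      4 * Real.pi ^ 2 * r ^ 4 / J +
        2 * (J + 1) * (Real.exp (Real.pi ^ 3 * ρ ^ 3) * Real.exp (-(a / (4 * √r)))) := by
  have hJ0 : (0 : ℝ) < J := by linarith
  have hsqrt : √r ≤ r := by
    rw [Real.sqrt_le_left (by linarith)]
    nlinarith
  have hsqrt1 : 1 ≤ √r := Real.one_le_sqrt.2 hr
  obtain ⟨η, hη⟩ : ∃ η, η = (r - √r) / J := ⟨_, rfl⟩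
  have hη0 : 0 ≤ η := by
    rw [hη]
    exact div_nonneg (by linarith) hJ0.le
  have hηr : η ≤ r / J := by
    rw [hη]
    gcongr
    linarith [Real.sqrt_nonneg r]
  have hη1 : η ≤ 1 := hηr.trans ((div_le_one hJ0).2 hJ)
  obtain ⟨s, hs⟩ : ∃ s : ℕ → ℝ, s = fun j : ℕ => r - j * η := ⟨_, rfl⟩
  have hs0 : s 0 = r := by simp [hs]
  have hsJ : s J = √r := by
    rw [hs, hη]
    field_simp
    ring
  have hanti : Antitone s := by
    rw [hs]
    intro i j hij
    have : (i : ℝ) ≤ j := by exact_mod_cast hij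
    simp only
    gcongr
  have hdiff : ∀ j, s j - s (j + 1) = η := by
    intro j
    rw [hs]
    push_cast
    ring
  have h := measure_le_maxDeviation_le hN hρ hanti (J := J) (by rwa [hsJ]) (by rwa [hsJ])
    (fun j hj => by
      have h1 : √r ≤ s (j + 1) := hsJ ▸ hanti hj
      linarith [hdiff j]) (a := a) (by rwa [hsJ])
  rw [hs0] at h
  have hterm : ∀ j ∈ Finset.range J, ENNReal.ofReal ((Real.pi * (s j ^ 2 - s (j + 1) ^ 2)) ^ 2) ≤
      ENNReal.ofReal (4 * Real.pi ^ 2 * r ^ 4 / J ^ 2) := by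
    intro j hj
    have hj' : j + 1 ≤ J := Finset.mem_range.1 hj
    have h1 : √r ≤ s (j + 1) := hsJ ▸ hanti hj'
    have h2 : s j ≤ r := hs0 ▸ hanti (Nat.zero_le j)
    have h3 : s (j + 1) ≤ r := hs0 ▸ hanti (Nat.zero_le _)
    have h4 : 0 ≤ s j := by linarith [hdiff j]
    apply ENNReal.ofReal_le_ofReal
    rw [sq_sub_sq, hdiff]
    calc (Real.pi * ((s j + s (j + 1)) * η)) ^ 2 ≤ (Real.pi * ((r + r) * (r / J))) ^ 2 := by
          gcongr
          exact mul_nonneg Real.pi_pos.le (mul_nonneg (by linarith) hη0)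
      _ = _ := by
          field_simp
          ring
  have h' := h.trans (add_le_add_left (Finset.sum_le_sum hterm) _)
  rw [Finset.sum_const, Finset.sum_const, Finset.card_range, Finset.card_range, nsmul_eq_mul,
    nsmul_eq_mul] at h'
  refine ENNReal.toReal_le_of_le_ofReal (by positivity) (h'.trans (le_of_eq ?_))
  rw [ENNReal.ofReal_add (by positivity) (by positivity), ← ENNReal.ofReal_natCast,
    ← ENNReal.ofReal_natCast, ← ENNReal.ofReal_ofNat, ← ENNReal.ofReal_mul (by positivity),
    ← ENNReal.ofReal_mul (by positivity), ← ENNReal.ofReal_mul (by positivity), sub_eq_add_neg,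
    Real.exp_add]
  congr 2
  · field_simp
  · push_cast
    ring

theorem isBigO_exp_neg_rpow {ε : ℝ} (hε : 0 < ε) (m : ℝ) :
    (fun r : ℝ => Real.exp (-(r ^ ε / 4))) =O[Filter.atTop] fun r => r ^ m := by
  have h := ((isLittleO_exp_neg_mul_rpow_atTop (a := 1 / 4) (by norm_num) (m / ε)).isBigO).comp_tendsto
    (tendsto_rpow_atTop hε)
  refine h.congr' (Filter.Eventually.of_forall fun r => ?_) ?_
  · simp only [Function.comp]
    congr 1
    ring
  · filter_upwards [Filter.eventually_ge_atTop 0] with r hr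
    simp only [Function.comp]
    rw [← Real.rpow_mul hr, mul_div_cancel₀ _ hε.ne']

end Deviation

end RadialPoissonTree

theorem mainTheorem5 {Ω : Type*} [MeasurableSpace Ω] (P : Measure Ω) [IsProbabilityMeasure P]
    (N : Ω → Set ℂ) (hN : RadialPoissonTree.IsUnitPoissonProcess P N)
    (ρ : ℝ) (hρ : 0 < ρ) (ε : ℝ) (hε : 0 < ε) (n : ℕ) :
    (fun r : ℝ => P.real {ω | r ^ ((1 / 2 : ℝ) + ε) ≤ RadialPoissonTree.maxDeviation ρ (N ω) r})
      =O[Filter.atTop] fun r : ℝ => r ^ (-(n : ℤ)) := by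
  have hexp := RadialPoissonTree.isBigO_exp_neg_rpow hε (-(2 * n + 4 : ℝ))
  obtain ⟨C, hC0, hC⟩ := hexp.exists_pos
  rw [Asymptotics.isBigOWith_iff] at hC
  have ht1 := (Real.tendsto_sqrt_atTop.eventually_ge_atTop (2 * ρ))
  have ht2 := (Real.tendsto_sqrt_atTop.comp Real.tendsto_sqrt_atTop).eventually_ge_atTop
    (Real.pi / 2 * ρ)
  have ht3 := (tendsto_rpow_atTop hε).eventually_ge_atTop 2
  refine Asymptotics.IsBigO.of_bound
    (4 * Real.pi ^ 2 + 6 * (Real.exp (Real.pi ^ 3 * ρ ^ 3) * C)) ?_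
  filter_upwards [hC, ht1, ht2, ht3, Filter.eventually_ge_atTop 1] with r hC h1 h2 h3 hr
  have hr0 : 0 < r := by linarith
  have hsqrt : 0 < √r := Real.sqrt_pos.2 hr0
  have ha : r ^ ((1 / 2 : ℝ) + ε) = √r * r ^ ε := by
    rw [Real.rpow_add hr0, Real.sqrt_eq_rpow]
  -- `⌈r ^ (n + 4)⌉₊` shells are so thin that two points in one of them are unlikely enough.
  have hJ := Nat.le_ceil (r ^ (n + 4))
  have hJ' := (Nat.ceil_lt_add_one (a := r ^ (n + 4)) (by positivity)).le
  have hpow : 1 ≤ r ^ (n + 4) := one_le_pow₀ hr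
  have hrJ : r ≤ r ^ (n + 4) := le_self_pow₀ hr (by omega)
  generalize ⌈r ^ (n + 4)⌉₊ = J at hJ hJ'
  have h := RadialPoissonTree.measure_le_maxDeviation_le_of_one_le hN hρ hr h1 h2
    (a := r ^ ((1 / 2 : ℝ) + ε)) (by rw [ha]; nlinarith) (hrJ.trans hJ)
  rw [show r ^ ((1 / 2 : ℝ) + ε) / (4 * √r) = r ^ ε / 4 by rw [ha]; field_simp] at h
  rw [Real.norm_of_nonneg (Real.exp_pos _).le, Real.norm_of_nonneg (by positivity)] at hC
  have e : r ^ (-(2 * n + 4 : ℝ)) = r ^ (-(n : ℤ)) / r ^ (n + 4) := by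
    rw [Real.rpow_neg hr0.le, zpow_neg, zpow_natCast,
      show (2 * n + 4 : ℝ) = ((n + (n + 4) : ℕ) : ℝ) by push_cast; ring, Real.rpow_natCast, pow_add]
    field_simp
  rw [e] at hC
  rw [Real.norm_of_nonneg measureReal_nonneg, Real.norm_of_nonneg (by positivity), add_mul]
  refine h.trans (add_le_add ?_ ?_)
  · calc 4 * Real.pi ^ 2 * r ^ 4 / J ≤ 4 * Real.pi ^ 2 * r ^ 4 / r ^ (n + 4) := by gcongr
      _ = _ := by
        rw [zpow_neg, zpow_natCast, pow_add]
        field_simp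
  · calc _ ≤ 2 * (3 * r ^ (n + 4)) * (Real.exp (Real.pi ^ 3 * ρ ^ 3) *
          (C * (r ^ (-(n : ℤ)) / r ^ (n + 4)))) := by
          gcongr
          linarith
      _ = _ := by
        field_simp
        ring
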